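/- For $n\ge 0$ let $[n]=\{1,2,\dots,n\}$. An arc of a set partition $\pi$ of $[n]$ is a pair $(i,j)$ of integers $i<j$ lying in the same block of $\pi$ such that this block contains no integer strictly between $i$ and $j$. For $k\ge 0$, let $\operatorname{NC}_k(n)$ be the set of $k$-distant noncrossing partitions of $[n]$, that is, of the set partitions of $[n]$ that have no two arcs $(a,c)$ and $(b,d)$ with $a<b\le c<d$ and $c-b\ge k$. A Motzkin path of length $n$ is a lattice path from $(0,0)$ to $(n,0)$ with steps $U=(1,1)$, $D=(1,-1)$ and $H=(1,0)$ that never goes below the $x$-axis; the height of a step is the $y$-coordinate of its ending point. Given sequences $b=(b_0,b_1,\dots)$ and $\lambda=(\lambda_0,\lambda_1,\dots)$, the weight of a Motzkin path is the product of $b_i$ over its horizontal steps and of $\lambda_i$ over its down steps, where $i$ is the height of the step. Let $\operatorname{Mot}_n(b,\lambda)$ be the sum of the weights of all Motzkin paths of length $n$. Theorem. Let $b_0=\lambda_0=1$ and, for $m\ge 1$, $$b_m = 3-\frac{1}{F_{2m-1}F_{2m-3}},\qquad \lambda_m = 1+\frac{1}{F_{2m-1}^2},$$ where $F_m$ is the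 Fibonacci number defined by $F_0=0$, $F_1=1$ and $F_m=F_{m-1}+F_{m-2}$ for all integers $m$ (so $F_{-1}=1$). Then, for every integer $n\ge 0$, $$\#\operatorname{NC}_2(n)=\operatorname{Mot}_n(b,\lambda).$$ -/

import Mathlib

namespace Motzkin

/-- `(i, j)` is an arc of the set partition `π` of `{1, …, n}`: the integers `i < j` lie in the
same block and this block contains no integer strictly between them. -/
def IsArc {n : ℕ} (π : Finpartition (Finset.Icc 1 n)) (i j : ℕ) : Prop :=
  i < j ∧ ∃ B ∈ π.parts, i ∈ B ∧ j ∈ B ∧ ∀ m ∈ B, ¬ (i < m ∧ m < j)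

/-- `π` is `k`-distant noncrossing: there are no two arcs `(a, c)` and `(b, d)` with
`a < b ≤ c < d` and `c - b ≥ k`. -/
def IsDistantNoncrossing {n : ℕ} (k : ℕ) (π : Finpartition (Finset.Icc 1 n)) : Prop :=
  ¬ ∃ a b c d : ℕ, IsArc π a c ∧ IsArc π b d ∧ a < b ∧ b ≤ c ∧ c < d ∧ b + k ≤ c

/-- The set of `k`-distant noncrossing partitions of `{1, …, n}`. -/
def NC (k n : ℕ) : Set (Finpartition (Finset.Icc 1 n)) :=
  {π | IsDistantNoncrossing k π}

/-- The steps `U = (1, 1)`, `D = (1, -1)` and `H = (1, 0)`. -/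
inductive Step : Type
  | U
  | D
  | H
  deriving DecidableEq

instance : Fintype Step where
  elems := {Step.U, Step.D, Step.H}
  complete s := by cases s <;> decide

/-- The change of the `y`-coordinate along a step. -/
def Step.rise : Step → ℤ
  | .U => 1
  | .D => -1
  | .H => 0

/-- The `y`-coordinate, after the first `j` steps, of the lattice path with steps `p` that starts
at `(0, 0)`. -/
def ycoord {n : ℕ} (p : Fin n → Step) (j : ℕ) : ℤ :=
  ∑ i : Fin n, if (i : ℕ) < j then (p i).rise else 0

/-- The lattice path with steps `p` from `(0, 0)` ends at `(n, 0)` and never goes below the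
`x`-axis. -/
def IsMotzkinPath {n : ℕ} (p : Fin n → Step) : Prop :=
  ycoord p n = 0 ∧ ∀ j ≤ n, 0 ≤ ycoord p j

/-- The height of the step number `i` (counted from `0`), which is the `y`-coordinate of its ending
point. It is nonnegative on Motzkin paths, the only paths for which it is used. -/
def stepHeight {n : ℕ} (p : Fin n → Step) (i : Fin n) : ℕ :=
  (ycoord p ((i : ℕ) + 1)).toNat

/-- The weight of one step of height `h`. -/
def Step.weight (b lam : ℕ → ℚ) : Step → ℕ → ℚ
  | .U, _ => 1
  | .D, h => lam h
  | .H, h => b h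

/-- The weight of a path: the product of the weights of its steps. -/
def pathWeight (b lam : ℕ → ℚ) {n : ℕ} (p : Fin n → Step) : ℚ :=
  ∏ i : Fin n, (p i).weight b lam (stepHeight p i)

open Classical in
/-- The sum of the weights of all Motzkin paths of length `n` with respect to `(b, lam)`. -/
noncomputable def Mot (b lam : ℕ → ℚ) (n : ℕ) : ℚ :=
  ∑ p : Fin n → Step with IsMotzkinPath p, pathWeight b lam p

end Motzkin

/-! A set partition is determined by its predecessor function, sending each point to its predecessor
in its block or to 0 (`predFun_injective`, `predFun_image_NC`). Insert the points in increasing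
order and give a 2-distant noncrossing partition the label k, one less than the number of points
that may still precede the next one. Its extensions then have labels k + 1, k and 1, …, k
(`IsPredFun.treeCount_succ`), so #NC_2(n + 1) is `treeCount n 0`.

Taking differences in k makes this rule tridiagonal: T_j = `treeDiff n j` evolves with coefficients
2, 3, 3, … on the diagonal and 1 beside it. The Motzkin weights come from the same system by a
bidiagonal change of variables. With S_h = `suffixWeight b lam n h` and f_h = `oddFib h`, one has
T_0 = S_1 + S_0 and T_h = S_{h+1} + (f_{h-1}/f_h) S_h for h ≥ 1. At length n + 1 the suffix weights
are T_0 at height 0 and T_{h+1} + (f_{h+1}/f_h) T_h at height h + 1. Composing the two maps gives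
exactly the stated b and λ (`suffixWeight_eq`). -/

namespace Motzkin

/-! ### Weighted Motzkin paths -/

/-- The total weight of the lattice paths of length `n` that start at height `h`, end at height `0`
and never go below the `x`-axis. -/
def suffixWeight (b lam : ℕ → ℚ) : ℕ → ℕ → ℚ
  | 0, h => if h = 0 then 1 else 0
  | n + 1, 0 => suffixWeight b lam n 1 + b 0 * suffixWeight b lam n 0
  | n + 1, h + 1 => suffixWeight b lam n (h + 2) + b (h + 1) * suffixWeight b lam n (h + 1)
      + lam h * suffixWeight b lam n h

/-- Shifted up by `h`, the path `p` ends on the `x`-axis and never goes below it. -/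
def IsMotzkinFrom (h : ℤ) {n : ℕ} (p : Fin n → Step) : Prop :=
  h + ycoord p n = 0 ∧ ∀ j ≤ n, 0 ≤ h + ycoord p j

/-- The weight of the path `p` shifted up by `h`. -/
def weightFrom (b lam : ℕ → ℚ) (h : ℤ) {n : ℕ} (p : Fin n → Step) : ℚ :=
  ∏ i : Fin n, (p i).weight b lam (h + ycoord p ((i : ℕ) + 1)).toNat

lemma ycoord_zero {n : ℕ} (p : Fin n → Step) : ycoord p 0 = 0 := by
  simp [ycoord]

lemma ycoord_cons_succ {n : ℕ} (s : Step) (p : Fin n → Step) (j : ℕ) :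
    ycoord (Fin.cons s p : Fin (n + 1) → Step) (j + 1) = s.rise + ycoord p j := by
  simp [ycoord, Fin.sum_univ_succ]

lemma isMotzkinFrom_cons {n : ℕ} (h : ℤ) (s : Step) (p : Fin n → Step) :
    IsMotzkinFrom h (Fin.cons s p : Fin (n + 1) → Step) ↔
      0 ≤ h ∧ IsMotzkinFrom (h + s.rise) p := by
  unfold IsMotzkinFrom
  rw [ycoord_cons_succ, ← add_assoc]
  constructor
  · rintro ⟨h₁, h₂⟩
    refine ⟨by simpa [ycoord_zero] using h₂ 0 (by omega), h₁, fun j hj => ?_⟩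
    simpa [ycoord_cons_succ, add_assoc] using h₂ (j + 1) (by omega)
  · rintro ⟨h₀, h₁, h₂⟩
    refine ⟨h₁, fun j hj => ?_⟩
    cases j with
    | zero => simpa [ycoord_zero] using h₀
    | succ j => simpa [ycoord_cons_succ, add_assoc] using h₂ j (by omega)

lemma weightFrom_cons {n : ℕ} (b lam : ℕ → ℚ) (h : ℤ) (s : Step) (p : Fin n → Step) :
    weightFrom b lam h (Fin.cons s p : Fin (n + 1) → Step) =
      s.weight b lam (h + s.rise).toNat * weightFrom b lam (h + s.rise) p := by
  simp [weightFrom, Fin.prod_univ_succ, ycoord_cons_succ, ycoord_zero, add_assoc]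

open Classical in
lemma sum_weightFrom_succ (b lam : ℕ → ℚ) (n : ℕ) (h : ℤ) (hh : 0 ≤ h) :
    (∑ p : Fin (n + 1) → Step with IsMotzkinFrom h p, weightFrom b lam h p) =
      ∑ s : Step, s.weight b lam (h + s.rise).toNat *
        ∑ p : Fin n → Step with IsMotzkinFrom (h + s.rise) p, weightFrom b lam (h + s.rise) p := by
  rw [Finset.sum_filter, ← (Fin.consEquiv (fun _ => Step)).sum_comp, Fintype.sum_prod_type]
  refine Finset.sum_congr rfl fun s _ => ?_
  rw [Finset.mul_sum, Finset.sum_filter]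
  refine Finset.sum_congr rfl fun p _ => ?_
  change (if IsMotzkinFrom h (Fin.cons s p : Fin (n + 1) → Step) then
    weightFrom b lam h (Fin.cons s p : Fin (n + 1) → Step) else 0) = _
  simp only [isMotzkinFrom_cons, weightFrom_cons, hh, true_and]

open Classical in
lemma sum_weightFrom_of_neg (b lam : ℕ → ℚ) (n : ℕ) (h : ℤ) (hh : h < 0) :
    (∑ p : Fin n → Step with IsMotzkinFrom h p, weightFrom b lam h p) = 0 := by
  rw [Finset.filter_false_of_mem, Finset.sum_empty]
  intro p _ hp
  have := hp.2 0 (Nat.zero_le n)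
  rw [ycoord_zero] at this
  omega

lemma sum_step (f : Step → ℚ) : ∑ s : Step, f s = f .U + f .D + f .H := by
  have : (Finset.univ : Finset Step) = {Step.U, Step.D, Step.H} := rfl
  rw [this, Finset.sum_insert (by decide), Finset.sum_insert (by decide), Finset.sum_singleton,
    add_assoc]

open Classical in
lemma sum_weightFrom (b lam : ℕ → ℚ) (n h : ℕ) :
    (∑ p : Fin n → Step with IsMotzkinFrom h p, weightFrom b lam h p) =
      suffixWeight b lam n h := by
  induction n generalizing h with
  | zero =>
    rw [Finset.sum_filter, Fintype.sum_unique]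
    simp [IsMotzkinFrom, weightFrom, suffixWeight, ycoord]
  | succ n ih =>
    rw [sum_weightFrom_succ b lam n h (by positivity), sum_step]
    have hU : (h : ℤ) + Step.U.rise = ((h + 1 : ℕ) : ℤ) := by simp [Step.rise]
    have hH : (h : ℤ) + Step.H.rise = (h : ℤ) := by simp [Step.rise]
    rw [hU, hH, ih, ih]
    cases h with
    | zero =>
      rw [sum_weightFrom_of_neg b lam n _ (by simp [Step.rise])]
      simp [suffixWeight, Step.weight]
    | succ h =>
      have hD : ((h + 1 : ℕ) : ℤ) + Step.D.rise = (h : ℤ) := by simp [Step.rise]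
      rw [hD, ih]
      simp only [suffixWeight, Step.weight, Int.toNat_natCast]
      ring

open Classical in
lemma Mot_eq_suffixWeight (b lam : ℕ → ℚ) (n : ℕ) : Mot b lam n = suffixWeight b lam n 0 := by
  rw [← sum_weightFrom, Mot]
  refine Finset.sum_congr (Finset.filter_congr fun p _ => ?_) fun p _ => ?_
  · simp [IsMotzkinFrom, IsMotzkinPath]
  · simp [weightFrom, pathWeight, stepHeight]

/-! ### The generating tree -/

/-- The number of nodes at depth `n` below a node with label `k` in the generating tree in which a
node with label `k` has children with the labels `k + 1`, `k` and `1, …, k`. -/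
def treeCount : ℕ → ℕ → ℚ
  | 0, _ => 1
  | n + 1, k => treeCount n (k + 1) + treeCount n k + ∑ i ∈ Finset.range k, treeCount n (i + 1)

/-- The iterated differences of `treeCount n` at `0`. -/
def treeDiff (n j : ℕ) : ℚ := ((fwdDiff 1)^[j] (treeCount n)) 0

lemma treeDiff_zero_left (j : ℕ) : treeDiff 0 j = if j = 0 then 1 else 0 := by
  have h1 : treeCount 0 = fun _ => 1 := by
    funext k
    simp [treeCount]
  cases j with
  | zero => simp [treeDiff, h1]
  | succ j =>
    have h2 : fwdDiff 1 (fun _ : ℕ => (1 : ℚ)) = 0 := by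
      funext k
      simp [fwdDiff]
    have h3 : ∀ i : ℕ, (fwdDiff 1)^[i] (0 : ℕ → ℚ) = 0 := fun i =>
      Function.iterate_fixed (by funext k; simp [fwdDiff]) i
    simp [treeDiff, h1, Function.iterate_succ_apply, h2, h3]

lemma treeDiff_succ_zero (n : ℕ) : treeDiff (n + 1) 0 = treeDiff n 1 + 2 * treeDiff n 0 := by
  simp [treeDiff, treeCount, fwdDiff]
  ring

/-- Differencing in the label collapses the sum over the children 1, …, k to a single term, which
leaves a recursion with constant coefficients. -/
lemma treeDiff_succ_succ (n j : ℕ) :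
    treeDiff (n + 1) (j + 1) = treeDiff n (j + 2) + 3 * treeDiff n (j + 1) + treeDiff n j := by
  have h : fwdDiff 1 (treeCount (n + 1)) =
      (fwdDiff 1)^[2] (treeCount n) + ((3 : ℚ) • fwdDiff 1 (treeCount n) + treeCount n) := by
    funext k
    simp [treeCount, fwdDiff, Finset.sum_range_succ]
    ring
  simp only [treeDiff]
  rw [Function.iterate_succ_apply, h, fwdDiff_iter_add, fwdDiff_iter_add, fwdDiff_iter_const_smul,
    ← Function.iterate_add_apply, ← Function.iterate_succ_apply]
  simp [add_assoc]

/-! ### Fibonacci numbers with odd indices -/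

/-- The Fibonacci number with index `2 h - 1`. -/
def oddFib (h : ℕ) : ℚ := (Int.fib (2 * (h : ℤ) - 1) : ℚ)

lemma oddFib_zero : oddFib 0 = 1 := by
  simp [oddFib]

lemma oddFib_one : oddFib 1 = 1 := by
  norm_num [oddFib]

lemma oddFib_add_two (h : ℕ) : oddFib (h + 2) = 3 * oddFib (h + 1) - oddFib h := by
  have e1 := Int.fib_add_two (n := 2 * (h : ℤ) - 1)
  have e2 := Int.fib_add_two (n := 2 * (h : ℤ))
  have e3 := Int.fib_add_two (n := 2 * (h : ℤ) + 1)
  have i1 : 2 * ((h + 2 : ℕ) : ℤ) - 1 = 2 * (h : ℤ) + 1 + 2 := by push_cast; ring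
  have i2 : 2 * ((h + 1 : ℕ) : ℤ) - 1 = 2 * (h : ℤ) + 1 := by push_cast; ring
  have i3 : 2 * (h : ℤ) - 1 + 2 = 2 * (h : ℤ) + 1 := by ring
  have i4 : 2 * (h : ℤ) - 1 + 1 = 2 * (h : ℤ) := by ring
  have i5 : 2 * (h : ℤ) + 1 + 1 = 2 * (h : ℤ) + 2 := by ring
  rw [i3, i4] at e1
  rw [i5] at e3
  simp only [oddFib, i1, i2]
  have : Int.fib (2 * (h : ℤ) + 1 + 2) =
      3 * Int.fib (2 * (h : ℤ) + 1) - Int.fib (2 * (h : ℤ) - 1) := by linarith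
  rw [this]
  push_cast
  ring

lemma oddFib_pos_and_le (h : ℕ) : 0 < oddFib h ∧ oddFib h ≤ oddFib (h + 1) := by
  induction h with
  | zero => simp [oddFib_zero, oddFib_one]
  | succ h ih =>
    rw [oddFib_add_two]
    constructor <;> linarith [ih.1, ih.2]

lemma oddFib_pos (h : ℕ) : 0 < oddFib h := (oddFib_pos_and_le h).1

lemma oddFib_mul (h : ℕ) : oddFib (h + 2) * oddFib h = oddFib (h + 1) ^ 2 + 1 := by
  induction h with
  | zero => norm_num [oddFib_add_two, oddFib_zero, oddFib_one]
  | succ h ih =>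
    rw [oddFib_add_two (h + 1)]
    rw [oddFib_add_two h] at ih ⊢
    linear_combination ih

/-! ### Comparison of the two recursions -/

/-- The numerators of the weights `suffixWeight b lam n (h + 1)` over `oddFib h`. -/
def suffixNumerator (a : ℕ → ℚ) (n : ℕ) : ℕ → ℚ
  | 0 => treeDiff n 0 - a n
  | h + 1 => oddFib (h + 1) * treeDiff n (h + 1) - suffixNumerator a n h

lemma suffixNumerator_zero_left {a : ℕ → ℚ} (ha : a 0 = 1) (h : ℕ) :
    suffixNumerator a 0 h = 0 := by
  induction h with
  | zero => simp [suffixNumerator, ha, treeDiff_zero_left]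
  | succ h ih => simp [suffixNumerator, ih, treeDiff_zero_left]

/-- The alternating sum telescopes because f_{h+2} = 3 f_{h+1} - f_h matches the coefficients 1, 3,
1 of the difference recursion. -/
lemma suffixNumerator_succ_left {a : ℕ → ℚ} (n h : ℕ) (ha : a (n + 1) = treeDiff n 0) :
    suffixNumerator a (n + 1) h =
      oddFib h * treeDiff n (h + 1) + oddFib (h + 1) * treeDiff n h := by
  induction h with
  | zero =>
    simp only [suffixNumerator, ha, treeDiff_succ_zero, oddFib_zero, zero_add, oddFib_one]
    ring
  | succ h ih =>
    rw [suffixNumerator, ih, treeDiff_succ_succ, oddFib_add_two]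
    ring

lemma suffixWeight_eq {b lam a : ℕ → ℚ} (hb0 : b 0 = 1) (hlam0 : lam 0 = 1)
    (hb : ∀ h, b (h + 1) = 3 - 1 / (oddFib (h + 1) * oddFib h))
    (hlam : ∀ h, lam (h + 1) = 1 + 1 / oddFib (h + 1) ^ 2)
    (ha0 : a 0 = 1) (ha : ∀ n, a (n + 1) = treeDiff n 0) (n : ℕ) :
    suffixWeight b lam n 0 = a n ∧
      ∀ h, suffixWeight b lam n (h + 1) = suffixNumerator a n h / oddFib h := by
  induction n with
  | zero => simp [suffixWeight, ha0, suffixNumerator_zero_left ha0]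
  | succ n ih =>
    obtain ⟨ih0, ih1⟩ := ih
    constructor
    · rw [suffixWeight, ih1, ih0, hb0, ha, suffixNumerator, oddFib_zero]
      ring
    · intro h
      rw [suffixWeight, ih1, ih1, suffixNumerator_succ_left n h (ha n), hb]
      cases h with
      | zero =>
        rw [ih0, hlam0]
        simp only [suffixNumerator, oddFib_zero, oddFib_one, zero_add]
        ring
      | succ h =>
        rw [ih1, hlam]
        simp only [suffixNumerator]
        have p0 := (oddFib_pos h).ne'
        have p1 := (oddFib_pos (h + 1)).ne'
        have p2 := (oddFib_pos (h + 2)).ne'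
        have r := oddFib_add_two h
        have q := oddFib_mul h
        have e : oddFib h = 3 * oddFib (h + 1) - oddFib (h + 2) := by linarith
        have hl : 1 + 1 / oddFib (h + 1) ^ 2 = oddFib (h + 2) * oddFib h / oddFib (h + 1) ^ 2 := by
          rw [q]
          field_simp
        rw [hl]
        rw [e] at q
        field_simp
        -- With x = f_{h+1} and y = f_{h+2}, `q` now says 3xy = x² + y² + 1, that is, 3 - 1/(xy) =
        -- x/y + y/x.
        generalize suffixNumerator a n h = u
        linear_combination (oddFib (h + 1) * treeDiff n (h + 1) - u) * q

/-! ### Predecessor functions -/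

/-- The points of `{1, …, n}` that may become the predecessor of `n + 1` when `f` is the
predecessor function of a 2-distant noncrossing partition of `{1, …, n}`. -/
noncomputable def available (n : ℕ) (f : ℕ → ℕ) : Finset ℕ :=
  open Classical in {x ∈ Finset.Icc 1 n | ∀ c ∈ Finset.Icc 1 n,
    f c ≠ x ∧ (f c ≠ 0 → f c < x → c ≤ x + 1)}

lemma mem_available {n : ℕ} {f : ℕ → ℕ} {x : ℕ} :
    x ∈ available n f ↔ (1 ≤ x ∧ x ≤ n) ∧
      ∀ c, 1 ≤ c → c ≤ n → f c ≠ x ∧ (f c ≠ 0 → f c < x → c ≤ x + 1) := by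
  simp [available]

/-- `f` maps every point of `{1, …, n}` to its predecessor in its block of a 2-distant
noncrossing partition, or to `0` if there is no predecessor. -/
structure IsPredFun (n : ℕ) (f : ℕ → ℕ) : Prop where
  le_of_ne_zero : ∀ c, f c ≠ 0 → c ≤ n
  lt_of_ne_zero : ∀ c, f c ≠ 0 → f c < c
  ne_of_lt : ∀ c d, c < d → f d ≠ 0 → f c ≠ f d
  noncrossing : ∀ c d, c < d → f d ≠ 0 → f c ≠ 0 → f c < f d → c ≤ f d + 1

/-- The predecessor functions of the 2-distant noncrossing partitions of `{1, …, n}`. -/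
noncomputable def predFuns : ℕ → Finset (ℕ → ℕ)
  | 0 => {0}
  | n + 1 => open Classical in (predFuns n).biUnion fun f =>
      (insert 0 (available n f)).image fun x => Function.update f (n + 1) x

lemma IsPredFun.apply_eq_zero {n : ℕ} {f : ℕ → ℕ} (hf : IsPredFun n f) {c : ℕ} (hc : n < c) :
    f c = 0 := by
  by_contra h
  have := hf.le_of_ne_zero c h
  omega

lemma IsPredFun.apply_zero {n : ℕ} {f : ℕ → ℕ} (hf : IsPredFun n f) : f 0 = 0 := by
  by_contra h
  have := hf.lt_of_ne_zero 0 h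
  omega

lemma IsPredFun.update {n : ℕ} {f : ℕ → ℕ} (hf : IsPredFun n f) {x : ℕ}
    (hx : x = 0 ∨ x ∈ available n f) : IsPredFun (n + 1) (Function.update f (n + 1) x) := by
  have hup : ∀ c, (c = n + 1 ∧ Function.update f (n + 1) x c = x) ∨
      (c ≠ n + 1 ∧ Function.update f (n + 1) x c = f c) := by
    intro c
    by_cases h : c = n + 1
    · subst h
      simp
    · simp [h]
  rw [mem_available] at hx
  have h0 := hf.apply_zero
  refine ⟨fun c hc => ?_, fun c hc => ?_, fun c d hcd hd => ?_, fun c d hcd hd hc hlt => ?_⟩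
  · have := hf.le_of_ne_zero c
    have := hup c
    omega
  · have := hf.lt_of_ne_zero c
    have := hup c
    omega
  · have h1 := hf.ne_of_lt c d hcd
    have h2 := hf.le_of_ne_zero d
    rcases hup c with ⟨e, h⟩ | ⟨e, h⟩ <;> rcases hup d with ⟨e', h'⟩ | ⟨e', h'⟩ <;>
      rw [h'] at hd <;> rw [h, h']
    · omega
    · have := h2 hd
      omega
    · rcases hx with hx | ⟨hx, hx'⟩
      · omega
      · rcases Nat.eq_zero_or_pos c with rfl | hc
        · omega
        · exact (hx' c hc (by omega)).1
    · exact h1 hd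
  · have h1 := hf.noncrossing c d hcd
    have h2 := hf.le_of_ne_zero d
    rcases hup c with ⟨e, h⟩ | ⟨e, h⟩ <;> rcases hup d with ⟨e', h'⟩ | ⟨e', h'⟩ <;>
      rw [h'] at hd <;> rw [h] at hc <;> rw [h, h'] at hlt <;> rw [h']
    · omega
    · have := h2 hd
      omega
    · rcases hx with hx | ⟨hx, hx'⟩
      · omega
      · rcases Nat.eq_zero_or_pos c with rfl | hc'
        · omega
        · exact (hx' c hc' (by omega)).2 hc hlt
    · exact h1 hd hc hlt

lemma IsPredFun.update_zero {n : ℕ} {f : ℕ → ℕ} (hf : IsPredFun (n + 1) f) :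
    IsPredFun n (Function.update f (n + 1) 0) := by
  have hup : ∀ c, (c = n + 1 ∧ Function.update f (n + 1) 0 c = 0) ∨
      (c ≠ n + 1 ∧ Function.update f (n + 1) 0 c = f c) := by
    intro c
    by_cases h : c = n + 1
    · subst h
      simp
    · simp [h]
  refine ⟨fun c hc => ?_, fun c hc => ?_, fun c d hcd hd => ?_, fun c d hcd hd hc hlt => ?_⟩
  · have := hf.le_of_ne_zero c
    have := hup c
    omega
  · have := hf.lt_of_ne_zero c
    have := hup c
    omega
  · have := hf.ne_of_lt c d hcd
    have := hup c
    have := hup d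
    omega
  · have := hf.noncrossing c d hcd
    have := hup c
    have := hup d
    omega

lemma IsPredFun.apply_mem_available {n : ℕ} {f : ℕ → ℕ} (hf : IsPredFun (n + 1) f)
    (h : f (n + 1) ≠ 0) : f (n + 1) ∈ available n (Function.update f (n + 1) 0) := by
  rw [mem_available]
  have := hf.lt_of_ne_zero _ h
  refine ⟨by omega, fun c hc hcn => ?_⟩
  rw [Function.update_of_ne (by omega)]
  exact ⟨hf.ne_of_lt c _ (by omega) h, hf.noncrossing c _ (by omega) h⟩

lemma mem_predFuns {n : ℕ} {f : ℕ → ℕ} : f ∈ predFuns n ↔ IsPredFun n f := by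
  induction n generalizing f with
  | zero =>
    simp only [predFuns, Finset.mem_singleton]
    constructor
    · rintro rfl
      constructor <;> simp
    · intro hf
      funext c
      rcases Nat.eq_zero_or_pos c with rfl | hc
      · exact hf.apply_zero
      · exact hf.apply_eq_zero hc
  | succ n ih =>
    simp only [predFuns, Finset.mem_biUnion, Finset.mem_image, Finset.mem_insert]
    constructor
    · rintro ⟨g, hg, x, hx, rfl⟩
      exact (ih.1 hg).update hx
    · intro hf
      refine ⟨_, ih.2 hf.update_zero, f (n + 1), ?_, by simp⟩
      by_cases h : f (n + 1) = 0
      · exact Or.inl h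
      · exact Or.inr (hf.apply_mem_available h)

/-- No extension is counted twice: members of `predFuns n` vanish beyond n, so resetting the value
at n + 1 to 0 recovers the function extended. -/
lemma sum_predFuns_succ (n : ℕ) (F : (ℕ → ℕ) → ℚ) :
    ∑ f ∈ predFuns (n + 1), F f =
      ∑ f ∈ predFuns n, ∑ x ∈ insert 0 (available n f), F (Function.update f (n + 1) x) := by
  classical
  have hrec : ∀ f ∈ predFuns n, ∀ x, Function.update (Function.update f (n + 1) x) (n + 1) 0 = f := by
    intro f hf x
    rw [Function.update_idem, Function.update_eq_self_iff]
    exact ((mem_predFuns.1 hf).apply_eq_zero (by omega)).symm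
  rw [predFuns, Finset.sum_biUnion]
  · refine Finset.sum_congr rfl fun f _ => ?_
    rw [Finset.sum_image]
    intro x _ y _ hxy
    exact Function.update_injective f (n + 1) hxy
  · intro f hf g hg hfg
    rw [Function.onFun, Finset.disjoint_left]
    intro u hu hu'
    rw [Finset.mem_image] at hu hu'
    obtain ⟨x, -, rfl⟩ := hu
    obtain ⟨y, -, hy⟩ := hu'
    apply hfg
    rw [← hrec f hf x, ← hrec g hg y, hy]

/-! ### Counting predecessor functions -/

lemma IsPredFun.self_mem_available {n : ℕ} {f : ℕ → ℕ} (hf : IsPredFun n f) (hn : 1 ≤ n) :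
    n ∈ available n f := by
  rw [mem_available]
  refine ⟨by omega, fun c hc hcn => ?_⟩
  have := hf.lt_of_ne_zero c
  omega

lemma IsPredFun.available_update_zero {n : ℕ} {f : ℕ → ℕ} (hf : IsPredFun n f) :
    available (n + 1) (Function.update f (n + 1) 0) = insert (n + 1) (available n f) := by
  have hlt := hf.lt_of_ne_zero
  ext y
  rw [Finset.mem_insert, mem_available, mem_available]
  constructor
  · rintro ⟨hy, h⟩
    by_cases hyn : y = n + 1
    · exact Or.inl hyn
    · refine Or.inr ⟨by omega, fun c hc hcn => ?_⟩
      simpa [show c ≠ n + 1 by omega] using h c hc (by omega)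
  · rintro (rfl | ⟨hy, h⟩)
    · refine ⟨by omega, fun c hc hcn => ?_⟩
      have := hlt c
      by_cases hcn' : c = n + 1
      · subst hcn'
        simp
      · rw [Function.update_of_ne hcn']
        omega
    · refine ⟨by omega, fun c hc hcn => ?_⟩
      by_cases hcn' : c = n + 1
      · subst hcn'
        simp
        omega
      · rw [Function.update_of_ne hcn']
        exact h c hc (by omega)

/-- The new arc (x, n + 1) uses up x and blocks each y with x < y < n; the point n survives under
it, since n + 1 is at distance only 1. -/
lemma IsPredFun.available_update {n x : ℕ} {f : ℕ → ℕ} (hf : IsPredFun n f)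
    (hx : x ∈ available n f) :
    available (n + 1) (Function.update f (n + 1) x) =
      insert (n + 1) ({y ∈ available n f | y < x ∨ (y = n ∧ x ≠ n)}) := by
  have hlt := hf.lt_of_ne_zero
  have hx' := (mem_available.1 hx).1
  ext y
  rw [Finset.mem_insert, Finset.mem_filter, mem_available, mem_available]
  constructor
  · rintro ⟨hy, h⟩
    by_cases hyn : y = n + 1
    · exact Or.inl hyn
    · refine Or.inr ⟨⟨by omega, fun c hc hcn => ?_⟩, ?_⟩
      · simpa [show c ≠ n + 1 by omega] using h c hc (by omega)
      · have := h (n + 1) (by omega) le_rfl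
        rw [Function.update_self] at this
        omega
  · rintro (rfl | ⟨⟨hy, h⟩, h'⟩)
    · refine ⟨by omega, fun c hc hcn => ?_⟩
      have := hlt c
      by_cases hcn' : c = n + 1
      · subst hcn'
        rw [Function.update_self]
        omega
      · rw [Function.update_of_ne hcn']
        omega
    · refine ⟨by omega, fun c hc hcn => ?_⟩
      by_cases hcn' : c = n + 1
      · subst hcn'
        rw [Function.update_self]
        omega
      · rw [Function.update_of_ne hcn']
        exact h c hc (by omega)

lemma sum_card_filter_lt (s : Finset ℕ) (F : ℕ → ℚ) :
    ∑ x ∈ s, F (Finset.card {y ∈ s | y < x}) = ∑ i ∈ Finset.range s.card, F i := by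
  induction s using Finset.induction_on_max with
  | empty => simp
  | insert a s hs ih =>
    have ha : a ∉ s := fun h => lt_irrefl a (hs a h)
    rw [Finset.sum_insert ha, Finset.card_insert_of_notMem ha, Finset.sum_range_succ, ← ih,
      add_comm]
    congr 1
    · refine Finset.sum_congr rfl fun x hx => ?_
      rw [Finset.filter_insert, if_neg (hs x hx).le.not_gt]
    · rw [Finset.filter_insert, if_neg (lt_irrefl a), Finset.filter_true_of_mem hs]

/-- The choice x = 0 raises the label by one and x = n keeps it. Any other available x with i
available points below it leaves those points, n and n + 1, hence the label i + 1. -/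
lemma IsPredFun.treeCount_succ {n : ℕ} {f : ℕ → ℕ} (hf : IsPredFun n f) (hn : 1 ≤ n) (r : ℕ) :
    treeCount (r + 1) ((available n f).card - 1) =
      ∑ x ∈ insert 0 (available n f),
        treeCount r ((available (n + 1) (Function.update f (n + 1) x)).card - 1) := by
  set A := available n f with hA
  have hnA : n ∈ A := hf.self_mem_available hn
  have hle : ∀ x ∈ A, 1 ≤ x ∧ x ≤ n := fun x hx => (mem_available.1 hx).1
  have h0 : 0 ∉ A := fun h => by have := hle 0 h; omega
  have hcard : 1 ≤ A.card := Finset.card_pos.2 ⟨n, hnA⟩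
  have hnew : ∀ p : ℕ → Prop, ∀ [DecidablePred p], n + 1 ∉ A.filter p := by
    intro p _ h
    have := hle _ (Finset.mem_of_mem_filter _ h)
    omega
  have hnA' : n + 1 ∉ A := fun h => by have := hle _ h; omega
  have e0 : (available (n + 1) (Function.update f (n + 1) 0)).card - 1 = A.card - 1 + 1 := by
    rw [hf.available_update_zero, Finset.card_insert_of_notMem hnA']
    omega
  have en : (available (n + 1) (Function.update f (n + 1) n)).card - 1 = A.card - 1 := by
    rw [hf.available_update hnA, Finset.card_insert_of_notMem (hnew _), Nat.add_sub_cancel,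
      ← Finset.card_erase_of_mem hnA]
    congr 1
    ext y
    have := hle y
    simp only [Finset.mem_filter, Finset.mem_erase]
    grind
  have ex : ∀ x ∈ A.erase n, (available (n + 1) (Function.update f (n + 1) x)).card - 1 =
      Finset.card {y ∈ A.erase n | y < x} + 1 := by
    intro x hx
    have hxn := Finset.ne_of_mem_erase hx
    have hxA := Finset.mem_of_mem_erase hx
    have := hle x hxA
    rw [hf.available_update hxA, Finset.card_insert_of_notMem (hnew _), Nat.add_sub_cancel,
      ← Finset.card_insert_of_notMem (a := n) (by simp)]
    congr 1
    ext y
    simp only [Finset.mem_filter, Finset.mem_insert, Finset.mem_erase]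
    grind
  have es := Finset.sum_congr (f := fun x =>
      treeCount r ((available (n + 1) (Function.update f (n + 1) x)).card - 1)) rfl
    fun x hx => congrArg (treeCount r) (ex x hx)
  rw [Finset.sum_insert h0, ← Finset.add_sum_erase A _ hnA, e0, en, treeCount, add_assoc, es,
    sum_card_filter_lt (A.erase n) (fun i => treeCount r (i + 1)), Finset.card_erase_of_mem hnA]

lemma sum_treeCount (n r : ℕ) :
    ∑ f ∈ predFuns (n + 1), treeCount r ((available (n + 1) f).card - 1) =
      treeCount (n + r) 0 := by
  induction n generalizing r with
  | zero =>
    have h1 : available 0 0 = ∅ := by simp [available]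
    have h2 : available 1 (0 : ℕ → ℕ) = {1} := by simp [available]
    have h3 : Function.update (0 : ℕ → ℕ) 1 0 = 0 := by simp
    rw [sum_predFuns_succ]
    simp [predFuns, h1, h2, h3]
  | succ n ih =>
    rw [sum_predFuns_succ, show n + 1 + r = n + (r + 1) by omega, ← ih]
    exact Finset.sum_congr rfl fun f hf =>
      ((mem_predFuns.1 hf).treeCount_succ (by omega) r).symm

lemma card_predFuns_zero : (predFuns 0).card = 1 := by
  simp [predFuns]

lemma card_predFuns_succ (n : ℕ) : ((predFuns (n + 1)).card : ℚ) = treeDiff n 0 := by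
  have := sum_treeCount n 0
  simpa [treeCount, treeDiff] using this

/-! ### Set partitions and predecessor functions -/

lemma isArc_iff {n : ℕ} {π : Finpartition (Finset.Icc 1 n)} {i j : ℕ} :
    IsArc π i j ↔ i < j ∧ i ∈ π.part j ∧ ∀ m ∈ π.part j, ¬ (i < m ∧ m < j) := by
  refine and_congr_right fun _ => ⟨?_, ?_⟩
  · rintro ⟨B, hB, hi, hj, h⟩
    rw [π.part_eq_of_mem hB hj]
    exact ⟨hi, h⟩
  · rintro ⟨hi, h⟩
    have hj : j ∈ Finset.Icc 1 n := by
      by_contra hj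
      rw [π.part_eq_empty.2 hj] at hi
      simp at hi
    exact ⟨π.part j, π.part_mem.2 hj, hi, π.mem_part_self.2 hj, h⟩

lemma part_eq_of_mem_part {n : ℕ} {π : Finpartition (Finset.Icc 1 n)} {i j : ℕ}
    (h : i ∈ π.part j) : π.part i = π.part j := by
  obtain ⟨p, hp, hi, hj⟩ := π.mem_part_iff_exists.1 h
  rw [π.part_eq_of_mem hp hi, π.part_eq_of_mem hp hj]

lemma mem_Icc_of_mem_part {n : ℕ} {π : Finpartition (Finset.Icc 1 n)} {i j : ℕ}
    (h : i ∈ π.part j) : (1 ≤ i ∧ i ≤ n) ∧ (1 ≤ j ∧ j ≤ n) := by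
  obtain ⟨p, hp, hi, hj⟩ := π.mem_part_iff_exists.1 h
  exact ⟨Finset.mem_Icc.1 (π.subset hp hi), Finset.mem_Icc.1 (π.subset hp hj)⟩

/-- The predecessor of `c` in its block, or `0` if there is none. -/
def predFun {n : ℕ} (π : Finpartition (Finset.Icc 1 n)) (c : ℕ) : ℕ :=
  {x ∈ π.part c | x < c}.sup id

lemma le_predFun {n : ℕ} {π : Finpartition (Finset.Icc 1 n)} {i c : ℕ} (h : i ∈ π.part c)
    (hi : i < c) : i ≤ predFun π c :=
  Finset.le_sup (f := id) (Finset.mem_filter.2 ⟨h, hi⟩)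

lemma predFun_eq_iff {n : ℕ} {π : Finpartition (Finset.Icc 1 n)} {i c : ℕ} (hi : i ≠ 0) :
    predFun π c = i ↔ IsArc π i c := by
  rw [isArc_iff]
  constructor
  · rintro rfl
    have hne : (Finset.filter (· < c) (π.part c)).Nonempty := by
      rw [Finset.nonempty_iff_ne_empty]
      intro h
      exact hi (by rw [predFun, h]; rfl)
    obtain ⟨x, hx, he⟩ := Finset.exists_mem_eq_sup _ hne id
    change predFun π c = x at he
    rw [Finset.mem_filter] at hx
    rw [he]
    refine ⟨hx.2, hx.1, fun m hm h => ?_⟩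
    have := le_predFun hm h.2
    omega
  · rintro ⟨h1, h2, h3⟩
    refine le_antisymm (Finset.sup_le fun m hm => ?_) (le_predFun h2 h1)
    rw [Finset.mem_filter] at hm
    have := h3 m hm.1
    simp only [id]
    omega

lemma isArc_predFun {n : ℕ} {π : Finpartition (Finset.Icc 1 n)} {c : ℕ} (h : predFun π c ≠ 0) :
    IsArc π (predFun π c) c :=
  (predFun_eq_iff h).1 rfl

lemma IsArc.predFun_eq {n : ℕ} {π : Finpartition (Finset.Icc 1 n)} {i c : ℕ} (h : IsArc π i c) :
    predFun π c = i := by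
  have := mem_Icc_of_mem_part (isArc_iff.1 h).2.1
  exact (predFun_eq_iff (by omega)).2 h

lemma isPredFun_predFun {n : ℕ} {π : Finpartition (Finset.Icc 1 n)} (hπ : π ∈ NC 2 n) :
    IsPredFun n (predFun π) := by
  refine ⟨fun c hc => ?_, fun c hc => (isArc_predFun hc).1, fun c d hcd hd h => ?_,
    fun c d hcd hd hc hlt => ?_⟩
  · exact (mem_Icc_of_mem_part (isArc_iff.1 (isArc_predFun hc)).2.1).2.2
  · have hc := isArc_iff.1 (isArc_predFun (h ▸ hd))
    have hd := isArc_iff.1 (isArc_predFun hd)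
    rw [← h] at hd
    have hcm : c ∈ π.part c := by
      have := mem_Icc_of_mem_part hc.2.1
      exact π.mem_part_self.2 (Finset.mem_Icc.2 this.2)
    rw [← part_eq_of_mem_part hc.2.1, part_eq_of_mem_part hd.2.1] at hcm
    exact hd.2.2 c hcm ⟨hc.1, hcd⟩
  · by_contra hlt'
    exact hπ ⟨_, _, c, d, isArc_predFun hc, isArc_predFun hd, hlt, by omega, hcd, by omega⟩

/-- Descending from j through successive predecessors reaches every smaller point of its block. -/
lemma mem_part_of_predFun_eq {n : ℕ} {π σ : Finpartition (Finset.Icc 1 n)}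
    (h : predFun π = predFun σ) {i j : ℕ} (hij : i < j) (hi : i ∈ π.part j) : i ∈ σ.part j := by
  induction j using Nat.strong_induction_on with
  | _ j ih =>
    have hle := le_predFun hi hij
    have hi' := mem_Icc_of_mem_part hi
    have hπ := isArc_iff.1 (isArc_predFun (π := π) (c := j) (by omega))
    have hσ := isArc_iff.1 (isArc_predFun (π := σ) (c := j) (by rw [← h]; omega))
    rw [← h] at hσ
    rcases hle.eq_or_lt with he | hlt
    · rw [he]
      exact hσ.2.1
    · rw [← part_eq_of_mem_part hσ.2.1]
      refine ih _ hπ.1 hlt ?_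
      rwa [part_eq_of_mem_part hπ.2.1]

lemma part_subset_of_predFun_eq {n : ℕ} {π σ : Finpartition (Finset.Icc 1 n)}
    (h : predFun π = predFun σ) (j : ℕ) : π.part j ⊆ σ.part j := by
  intro i hi
  rcases lt_trichotomy i j with hij | rfl | hij
  · exact mem_part_of_predFun_eq h hij hi
  · exact σ.mem_part_self.2 (π.mem_part_self.1 hi)
  · have hj : j ∈ π.part i := by
      rw [part_eq_of_mem_part hi, π.mem_part_self, Finset.mem_Icc]
      exact (mem_Icc_of_mem_part hi).2
    have hj' := mem_part_of_predFun_eq h hij hj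
    rw [part_eq_of_mem_part hj', σ.mem_part_self, Finset.mem_Icc]
    exact (mem_Icc_of_mem_part hi).1

lemma parts_subset_of_predFun_eq {n : ℕ} {π σ : Finpartition (Finset.Icc 1 n)}
    (h : predFun π = predFun σ) : π.parts ⊆ σ.parts := by
  intro B hB
  obtain ⟨x, hx⟩ := π.nonempty_of_mem_parts hB
  rw [← π.part_eq_of_mem hB hx, Finset.Subset.antisymm (part_subset_of_predFun_eq h x)
    (part_subset_of_predFun_eq h.symm x), σ.part_mem]
  exact π.subset hB hx

lemma predFun_injective (n : ℕ) :
    Function.Injective (predFun : Finpartition (Finset.Icc 1 n) → ℕ → ℕ) := fun _ _ h =>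
  Finpartition.ext
    (Finset.Subset.antisymm (parts_subset_of_predFun_eq h) (parts_subset_of_predFun_eq h.symm))

/-- The first element of the chain `c, f c, f (f c), …` that has no predecessor. -/
def root (f : ℕ → ℕ) (c : ℕ) : ℕ :=
  if f c ≠ 0 ∧ f c < c then root f (f c) else c
termination_by c

lemma root_of_eq_zero {f : ℕ → ℕ} {c : ℕ} (h : f c = 0) : root f c = c := by
  rw [root]
  simp [h]

lemma IsPredFun.root_apply {n : ℕ} {f : ℕ → ℕ} (hf : IsPredFun n f) {c : ℕ} (h : f c ≠ 0) :
    root f (f c) = root f c := by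
  rw [root.eq_def f c, if_pos ⟨h, hf.lt_of_ne_zero c h⟩]

lemma root_le (f : ℕ → ℕ) (c : ℕ) : root f c ≤ c := by
  induction c using Nat.strong_induction_on with
  | _ c ih =>
    rw [root]
    split_ifs with h
    · exact (ih _ h.2).trans h.2.le
    · exact le_rfl

/-- Chains with a common root cannot branch, as f is injective where it is nonzero. If f j < i, the
outer induction for the pair f j < i gives f j ≤ f i, injectivity makes this strict, and the inner
induction at f i gives f i ≤ f j. -/
lemma IsPredFun.le_apply_of_root_eq {n : ℕ} {f : ℕ → ℕ} (hf : IsPredFun n f) {i j : ℕ}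
    (hij : i < j) (h : root f i = root f j) : f j ≠ 0 ∧ i ≤ f j := by
  induction j using Nat.strong_induction_on generalizing i with
  | _ j ih =>
    have hj : f j ≠ 0 := by
      intro hj
      have := root_le f i
      rw [h, root_of_eq_zero hj] at this
      omega
    refine ⟨hj, ?_⟩
    induction i using Nat.strong_induction_on with
    | _ i ih' =>
      by_contra hlt
      have h1 := ih i hij (not_le.1 hlt) ((hf.root_apply hj).trans h.symm)
      have h2 := hf.ne_of_lt i j hij hj
      have h3 := hf.lt_of_ne_zero i h1.1
      have h4 := ih' (f i) h3 (by omega) ((hf.root_apply h1.1).trans h)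
      omega

/-- The partition of `{1, …, n}` whose blocks are the chains of `f`. -/
def rootPartition (n : ℕ) (f : ℕ → ℕ) : Finpartition (Finset.Icc 1 n) :=
  haveI : DecidableRel (Setoid.ker (root f)).r := fun a b => decEq (root f a) (root f b)
  Finpartition.ofSetSetoid (Setoid.ker (root f)) (Finset.Icc 1 n)

lemma mem_part_rootPartition {n : ℕ} {f : ℕ → ℕ} {i j : ℕ} :
    i ∈ (rootPartition n f).part j ↔
      (1 ≤ i ∧ i ≤ n) ∧ (1 ≤ j ∧ j ≤ n) ∧ root f i = root f j := by
  rw [rootPartition, Finpartition.mem_part_ofSetSetoid_iff_rel, Finset.mem_Icc,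
    Finset.mem_Icc, Setoid.ker_def, eq_comm (a := root f j)]
  tauto

lemma IsPredFun.predFun_rootPartition {n : ℕ} {f : ℕ → ℕ} (hf : IsPredFun n f) :
    predFun (rootPartition n f) = f := by
  funext c
  by_cases hc : f c = 0
  · rw [hc]
    by_contra h
    have h1 := isArc_iff.1 (isArc_predFun h)
    exact (hf.le_apply_of_root_eq h1.1 (mem_part_rootPartition.1 h1.2.1).2.2).1 hc
  · have h1 := hf.lt_of_ne_zero c hc
    have h2 := hf.le_of_ne_zero c hc
    rw [predFun_eq_iff hc, isArc_iff]
    refine ⟨h1, mem_part_rootPartition.2 ⟨by omega, by omega, hf.root_apply hc⟩, fun m hm hlt => ?_⟩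
    have := (hf.le_apply_of_root_eq hlt.2 (mem_part_rootPartition.1 hm).2.2).2
    omega

lemma IsPredFun.rootPartition_mem_NC {n : ℕ} {f : ℕ → ℕ} (hf : IsPredFun n f) :
    rootPartition n f ∈ NC 2 n := by
  rintro ⟨a, b, c, d, hac, hbd, hab, hbc, hcd, h⟩
  have hc := hac.predFun_eq
  have hd := hbd.predFun_eq
  have ha := mem_Icc_of_mem_part (isArc_iff.1 hac).2.1
  rw [hf.predFun_rootPartition] at hc hd
  have := hf.noncrossing c d hcd
  omega

lemma predFun_image_NC (n : ℕ) : predFun '' NC 2 n = (predFuns n : Set (ℕ → ℕ)) := by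
  ext f
  rw [Finset.mem_coe, mem_predFuns]
  constructor
  · rintro ⟨π, hπ, rfl⟩
    exact isPredFun_predFun hπ
  · exact fun hf => ⟨_, hf.rootPartition_mem_NC, hf.predFun_rootPartition⟩

lemma ncard_NC (n : ℕ) : (NC 2 n).ncard = (predFuns n).card := by
  rw [← Set.ncard_image_of_injective _ (predFun_injective n), predFun_image_NC,
    Set.ncard_coe_finset]

end Motzkin

/-- `Int.fib` is the Fibonacci sequence indexed by all integers, so `Int.fib (-1) = 1`. -/
theorem theorem1p1 (b lam : ℕ → ℚ) (hb0 : b 0 = 1) (hlam0 : lam 0 = 1)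
    (hb : ∀ n : ℕ, 1 ≤ n →
      b n = 3 - 1 / ((Int.fib (2 * (n : ℤ) - 1) : ℚ) * (Int.fib (2 * (n : ℤ) - 3) : ℚ)))
    (hlam : ∀ n : ℕ, 1 ≤ n →
      lam n = 1 + 1 / (Int.fib (2 * (n : ℤ) - 1) : ℚ) ^ 2)
    (n : ℕ) :
    ((Motzkin.NC 2 n).ncard : ℚ) = Motzkin.Mot b lam n := by
  have hb' : ∀ h, b (h + 1) = 3 - 1 / (Motzkin.oddFib (h + 1) * Motzkin.oddFib h) := by
    intro h
    rw [hb (h + 1) (by omega), Motzkin.oddFib, Motzkin.oddFib,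
      show 2 * ((h + 1 : ℕ) : ℤ) - 3 = 2 * (h : ℤ) - 1 by push_cast; ring]
  rw [Motzkin.Mot_eq_suffixWeight, Motzkin.ncard_NC]
  exact (Motzkin.suffixWeight_eq (a := fun n => ((Motzkin.predFuns n).card : ℚ)) hb0 hlam0 hb'
    (fun h => hlam (h + 1) (by omega)) (by simp [Motzkin.card_predFuns_zero])
    Motzkin.card_predFuns_succ n).1.symm
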